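/- Let $G$ be a finite group with $|G|\ge 2$ and identity $e_G$, and let $\mu$ be a probability measure on $G$ such that the transition matrix $P_\mu(x,y)=\mu(x^{-1}y)$, $x,y\in G$, is irreducible and aperiodic. For $\alpha\in[0,1)$, a step-reinforced random walk (SRRW) with step distribution $\mu$ and parameter $\alpha$ is the process defined by $S_0=e_G$, $S_n=S_{n-1}X_n$ for $n\ge1$, where $X_1$ is sampled from $\mu$ and, for $n\ge 2$, $X_n=X_{u_n}$ if $\xi_n=1$, while $X_n$ is a fresh independent sample from $\mu$ if $\xi_n=0$. Here the $\xi_n$ are Bernoulli with success probability $\alpha$, the $u_n$ are uniform on $\{1,\dots,n-1\}$, and all these variables and the samples from $\mu$ are independent. Put $$d_\infty(n)=\max_{x\in G}\bigl|\,|G|\,\mathbb P(S_n=x)-1\bigr|,\qquad \Gamma=\{x\in G:\mu(x)>0\},\qquad \Gamma^{-1}=\{x^{-1}:x\in\Gamma\}.$$ If the subgroup $\langle\Gamma\cdot\Gamma^{-1}\rangle$ generated by $\Gamma\cdot\Gamma^{-1}=\{ab^{-1}:a,b\in\Gamma\}$ is equal to $G$, then there exist constants $C>0$ and $\rho\in(0,1)$,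 depending only on $G$ and $\mu$ (not on $\alpha$), such that for every $\alpha\in[0,1)$, every SRRW with step distribution $\mu$ and parameter $\alpha$, and every $n\ge1$, $$d_\infty(n)\le C\rho^{(1-\alpha)n}.$$ In particular, $\langle\Gamma\cdot\Gamma^{-1}\rangle=G$, and hence this bound, holds in each of the following cases: (i) $\Gamma=\Gamma^{-1}$; (ii) $\Gamma$ is a union of conjugacy classes of $G$, which includes the case where $G$ is abelian; (iii) $e_G\in\Gamma$. -/

import Mathlib

open MeasureTheory ProbabilityTheory
open scoped Pointwise ENNReal

universe u v

namespace SRRW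

/-- The transition matrix `P_μ(x, y) = μ(x⁻¹ y)` of the classical random walk on `G` with step
distribution `μ`. -/
noncomputable def transitionMatrix {G : Type*} [Group G] (μ : PMF G) : Matrix G G ℝ :=
  Matrix.of fun x y => (μ (x⁻¹ * y)).toReal

/-- A nonnegative matrix is aperiodic if, for every state `x`, the greatest common divisor of the
set of return times `{t ≥ 1 : P^t(x, x) > 0}` is `1`, that is, the only natural number dividing
all these return times is `1`. -/
def IsAperiodic {V : Type*} [Fintype V] [DecidableEq V] (P : Matrix V V ℝ) : Prop :=
  ∀ x : V, ∀ d : ℕ, (∀ t : ℕ, 1 ≤ t → 0 < (P ^ t) x x → d ∣ t) → d = 1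

/-- The randomness and the recursion of a step-reinforced random walk started at the identity.
Times are natural numbers, and
* `ξ n` (`n ≥ 2`) are Bernoulli variables with success parameter `α`;
* `u n` (`n ≥ 2`) is uniformly distributed on `{1, …, n - 1}`;
* `Y n` (`n ≥ 1`) are the fresh samples from `μ`;
* all of these random variables are independent;
* `X n` (`n ≥ 1`) are the steps and `S n` (`n ≥ 0`) the positions of the walk.
The values `ξ 0, ξ 1, u 0, u 1, Y 0, X 0` are irrelevant. -/
structure IsConstruction {G Ω : Type*} [Group G] [MeasurableSpace Ω] (P : Measure Ω) (α : ℝ)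
    (μ : PMF G) (ξ : ℕ → Ω → Bool) (u : ℕ → Ω → ℕ) (Y X S : ℕ → Ω → G) : Prop where
  measurable_flag : ∀ n, 2 ≤ n → ∀ b : Bool, MeasurableSet {ω | ξ n ω = b}
  measurable_index : ∀ n, 2 ≤ n → ∀ k : ℕ, MeasurableSet {ω | u n ω = k}
  measurable_fresh : ∀ n, 1 ≤ n → ∀ A : Set G, MeasurableSet {ω | Y n ω ∈ A}
  law_flag : ∀ n, 2 ≤ n → P {ω | ξ n ω = true} = ENNReal.ofReal α
  index_mem : ∀ n, 2 ≤ n → ∀ ω, u n ω ∈ Finset.Icc 1 (n - 1)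
  law_index : ∀ n, 2 ≤ n → ∀ k ∈ Finset.Icc 1 (n - 1),
    P {ω | u n ω = k} = ((n - 1 : ℕ) : ℝ≥0∞)⁻¹
  law_fresh : ∀ n, 1 ≤ n → ∀ g : G, P {ω | Y n ω = g} = μ g
  /-- The family `(ξ n)_{n ≥ 2}, (u n)_{n ≥ 2}, (Y n)_{n ≥ 1}` is mutually independent: the
  σ-algebras generated by its members are independent. -/
  independent : iIndep
    (Sum.elim (fun n : ℕ => MeasurableSpace.comap (ξ (n + 2)) ⊤)
      (Sum.elim (fun n : ℕ => MeasurableSpace.comap (u (n + 2)) ⊤)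
        (fun n : ℕ => MeasurableSpace.comap (Y (n + 1)) ⊤))) P
  step_one : ∀ ω, X 1 ω = Y 1 ω
  step_reinforced : ∀ n, 2 ≤ n → ∀ ω, ξ n ω = true → X n ω = X (u n ω) ω
  step_fresh : ∀ n, 2 ≤ n → ∀ ω, ξ n ω = false → X n ω = Y n ω
  walk_zero : ∀ ω, S 0 ω = 1
  walk_succ : ∀ n ω, S (n + 1) ω = S n ω * X (n + 1) ω

/-- `S` is a step-reinforced random walk (started at the identity) with step distribution `μ`
and reinforcement parameter `α`, defined on the probability space `(Ω, P)`. -/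
def IsSRRW {G Ω : Type*} [Group G] [MeasurableSpace Ω] (P : Measure Ω) (α : ℝ)
    (μ : PMF G) (S : ℕ → Ω → G) : Prop :=
  ∃ (ξ : ℕ → Ω → Bool) (u : ℕ → Ω → ℕ) (Y X : ℕ → Ω → G), IsConstruction P α μ ξ u Y X S

/-- The uniform (`ℓ^∞`) distance `d_∞(n) = max_x |P(S_n = x) |G| - 1|`. -/
noncomputable def uniformDistance {G Ω : Type*} [Group G] [Fintype G] [MeasurableSpace Ω]
    (P : Measure Ω) (S : ℕ → Ω → G) (n : ℕ) : ℝ :=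
  Finset.univ.sup' Finset.univ_nonempty
    fun x : G => |P.real {ω | S n ω = x} * (Fintype.card G : ℝ) - 1|

/-- There are `C > 0` and `ρ ∈ (0, 1)`, depending only on `G` and `μ`, such that
`d_∞(n) ≤ C ρ^{(1 - α) n}` for every `α ∈ [0, 1)`, every step-reinforced random walk with
parameter `α` and step distribution `μ`, and every `n ≥ 1`. -/
def HasUniformDecay {G : Type u} [Group G] [Fintype G] (μ : PMF G) : Prop :=
  ∃ C ρ : ℝ, 0 < C ∧ 0 < ρ ∧ ρ < 1 ∧
    ∀ α : ℝ, 0 ≤ α → α < 1 →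
      ∀ (Ω : Type v) [MeasurableSpace Ω] (P : Measure Ω) [IsProbabilityMeasure P]
        (S : ℕ → Ω → G), IsSRRW P α μ S →
        ∀ n : ℕ, 1 ≤ n → uniformDistance P S n ≤ C * ρ ^ ((1 - α) * (n : ℝ))

end SRRW

/-! Call a time isolated up to time `n` if its step is a fresh sample that no later step up to `n`
has copied. Fix the flags and indices, hence the isolated set `A`, and the steps at all other times.
The samples at the times in `A` are still independent with law `μ`, and each occurs exactly once in
the product `S n`. So `S n` is a product of independent `μ`-steps and deterministic factors. A
deterministic factor is a translation and preserves the `ℓ²` distance to uniform. Each `μ`-step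
contracts it by a factor `exp (-t)`: by a variance identity, equality would make a mean-zero
function invariant under `⟨ΓΓ⁻¹⟩ = G` (`sum_conv_sq_lt`), and compactness makes this uniform
(`exists_conv_contraction`). Averaging bounds the pointwise error by the expectation of `exp (-t *
|A|)` (`abs_measureReal_walk_sub_le`).

It remains to bound this exponential moment. Under the flags and indices, the isolated set is a
Markov chain: with probability `1 - α` it gains the new time, otherwise a uniformly chosen past time
is erased if present. One step replaces the exponent `t` by `t * (n - 2) / n` and gains a factor
`exp (-(1 - α) * t / 2)` (`exp_moment_transition_le`). Exponents proportional to `(n - 1) * (n - 2)`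
follow this recursion exactly, and the gains add up to order `(1 - α) * t * n`, with a rate free of
`α`.

For the special cases, when `H = ⟨ΓΓ⁻¹⟩` is normal, `Γ` has a single image in `G ⧸ H`. Aperiodicity
makes this image trivial, and irreducibility then gives `H = G`. -/

namespace SRRW

/-! ### The subgroup generated by `ΓΓ⁻¹` -/

section Algebra

variable {G : Type*} [Group G]

/-- A homomorphism sending all of the support of `μ` to `c` sends the endpoint of a path of
length `t` to the image of its starting point times `c ^ t`. -/
lemma map_of_transitionMatrix_pow_ne_zero [Fintype G] [DecidableEq G] {K : Type*} [Group K]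
    {μ : PMF G} (φ : G →* K) {c : K} (hc : ∀ a ∈ μ.support, φ a = c) (t : ℕ) (x y : G)
    (h : (transitionMatrix μ ^ t) x y ≠ 0) : φ y = φ x * c ^ t := by
  induction t generalizing y with
  | zero =>
    have : x = y := by
      by_contra hxy
      exact h (by simp [Matrix.one_apply_ne hxy])
    simp [this]
  | succ t ih =>
    rw [pow_succ, Matrix.mul_apply] at h
    obtain ⟨z, -, hz⟩ := Finset.exists_ne_zero_of_sum_ne_zero h
    have h1 := ih z (left_ne_zero_of_mul hz)
    have h2 : z⁻¹ * y ∈ μ.support := by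
      rw [PMF.mem_support_iff]
      intro h0
      exact right_ne_zero_of_mul hz (by simp [transitionMatrix, h0])
    have h3 := hc _ h2
    rw [map_mul, map_inv, inv_mul_eq_iff_eq_mul] at h3
    rw [h3, h1, pow_succ, mul_assoc]

lemma mem_of_transitionMatrix_pow_ne_zero [Fintype G] [DecidableEq G] {μ : PMF G}
    {H : Subgroup G} (hH : μ.support ⊆ H) (t : ℕ) (y : G)
    (h : (transitionMatrix μ ^ t) 1 y ≠ 0) : y ∈ H := by
  induction t generalizing y with
  | zero =>
    have : 1 = y := by
      by_contra hxy
      exact h (by simp [Matrix.one_apply_ne hxy])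
    exact this ▸ H.one_mem
  | succ t ih =>
    rw [pow_succ, Matrix.mul_apply] at h
    obtain ⟨z, -, hz⟩ := Finset.exists_ne_zero_of_sum_ne_zero h
    have h1 := ih z (left_ne_zero_of_mul hz)
    have h2 : z⁻¹ * y ∈ μ.support := by
      rw [PMF.mem_support_iff]
      intro h0
      exact right_ne_zero_of_mul hz (by simp [transitionMatrix, h0])
    simpa using H.mul_mem h1 (hH h2)

lemma eq_top_of_support_subset [Fintype G] [DecidableEq G] {μ : PMF G}
    (hirr : (transitionMatrix μ).IsIrreducible) {H : Subgroup G} (hH : μ.support ⊆ H) :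
    H = ⊤ := by
  refine (Subgroup.eq_top_iff' H).2 fun y => ?_
  obtain ⟨k, -, hk⟩ := (Matrix.isIrreducible_iff_exists_pow_pos hirr.nonneg).1 hirr 1 y
  exact mem_of_transitionMatrix_pow_ne_zero hH k y hk.ne'

/-- If the walk is irreducible and aperiodic, then `⟨Γ Γ⁻¹⟩ = G` as soon as `⟨Γ Γ⁻¹⟩` is normal. -/
lemma closure_support_mul_inv_eq_top_of_normal [Fintype G] [DecidableEq G] {μ : PMF G}
    (hirr : (transitionMatrix μ).IsIrreducible) (haper : IsAperiodic (transitionMatrix μ))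
    (hN : (Subgroup.closure (μ.support * μ.support⁻¹)).Normal) :
    Subgroup.closure (μ.support * μ.support⁻¹) = ⊤ := by
  set H := Subgroup.closure (μ.support * μ.support⁻¹) with hHdef
  obtain ⟨a, ha⟩ := μ.support_nonempty
  have hc : ∀ b ∈ μ.support, QuotientGroup.mk' H b = QuotientGroup.mk' H a := by
    intro b hb
    have h1 : b * a⁻¹ ∈ H :=
      Subgroup.subset_closure (Set.mul_mem_mul hb (Set.inv_mem_inv.2 ha))
    have h2 : QuotientGroup.mk' H (b * a⁻¹) = 1 := (QuotientGroup.eq_one_iff _).2 h1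
    rwa [map_mul, map_inv, mul_inv_eq_one] at h2
  -- A return at time `t` forces `c ^ t = 1` for the common image `c` of `Γ`, so the order of `c`
  -- divides every return time.
  have hd := haper 1 (orderOf (QuotientGroup.mk' H a)) fun t _ ht => by
    have := map_of_transitionMatrix_pow_ne_zero (QuotientGroup.mk' H) hc t 1 1 ht.ne'
    rw [map_one, one_mul] at this
    exact orderOf_dvd_of_pow_eq_one this.symm
  rw [orderOf_eq_one_iff] at hd
  refine eq_top_of_support_subset hirr fun b hb => ?_
  exact (QuotientGroup.eq_one_iff _).1 ((hc b hb).trans hd)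

/-- The normalizer is a subgroup, so by irreducibility it is everything once it contains `Γ`;
conjugating the generators by elements of `Γ` is enough. -/
lemma closure_normal_of_support_conj [Fintype G] [DecidableEq G] {μ : PMF G}
    (hirr : (transitionMatrix μ).IsIrreducible)
    (h : ∀ b ∈ μ.support, ∀ x ∈ μ.support, ∀ y ∈ μ.support, b * (x * y⁻¹) * b⁻¹ ∈
      Subgroup.closure (μ.support * μ.support⁻¹)) :
    (Subgroup.closure (μ.support * μ.support⁻¹)).Normal := by
  set H := Subgroup.closure (μ.support * μ.support⁻¹) with hHdef
  rw [← Subgroup.normalizer_eq_top_iff]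
  refine eq_top_of_support_subset hirr fun b hb => ?_
  have hle : H ≤ H.comap (MulAut.conj b).toMonoidHom := by
    rw [hHdef, Subgroup.closure_le]
    rintro _ ⟨x, hx, y, hy, rfl⟩
    have := h b hb x hx y⁻¹ hy
    rw [inv_inv] at this
    simpa using this
  have hmem : ∀ k : ℕ, ∀ x ∈ H, b ^ k * x * (b ^ k)⁻¹ ∈ H := by
    intro k
    induction k with
    | zero => intro x hx; simpa using hx
    | succ k ih =>
      intro x hx
      have := hle (ih x hx)
      simp only [Subgroup.mem_comap, MulEquiv.toMonoidHom_eq_coe, MonoidHom.coe_coe,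
        MulAut.conj_apply] at this
      have e : b ^ (k + 1) * x * (b ^ (k + 1))⁻¹ = b * (b ^ k * x * (b ^ k)⁻¹) * b⁻¹ := by
        rw [pow_succ']; group
      rwa [e]
  rw [SetLike.mem_coe, Subgroup.mem_normalizer_iff]
  refine fun x => ⟨fun hx => by simpa using hmem 1 x hx, fun hx => ?_⟩
  -- Stability under conjugation by `b` gives only one inclusion; finiteness supplies the other,
  -- since `b⁻¹` is a positive or zero power of `b`.
  have h1 := hmem (orderOf b - 1) _ hx
  have h2 : b ^ (orderOf b - 1) = b⁻¹ := by
    rw [eq_inv_iff_mul_eq_one, ← pow_succ, Nat.sub_add_cancel (orderOf_pos b), pow_orderOf_eq_one]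
  rw [h2] at h1
  convert h1 using 1
  group

end Algebra

/-! ### Strict `ℓ²` contraction under convolution -/

section Contraction

variable {G : Type*} [Group G] [Fintype G]

lemma sum_pmf_toReal {G : Type*} [Fintype G] (μ : PMF G) : ∑ g, (μ g).toReal = 1 := by
  rw [← ENNReal.toReal_sum fun g _ => μ.apply_ne_top g,
    ← tsum_fintype (L := .unconditional G), μ.tsum_coe, ENNReal.toReal_one]

/-- Right convolution of a function with `μ`. -/
noncomputable def conv (μ : PMF G) (f : G → ℝ) (x : G) : ℝ :=
  ∑ g, (μ g).toReal * f (x * g⁻¹)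

lemma sum_comp_mul_right (f : G → ℝ) (a : G) : ∑ x, f (x * a) = ∑ x, f x :=
  Equiv.sum_comp (Equiv.mulRight a) f

lemma conv_const (μ : PMF G) (f : G → ℝ) (c : ℝ) (x : G) :
    conv μ (fun y => f y - c) x = conv μ f x - c := by
  simp only [conv, mul_sub, Finset.sum_sub_distrib, ← Finset.sum_mul, sum_pmf_toReal, one_mul]

lemma sum_weighted_variance {ι : Type*} [Fintype ι] (w a : ι → ℝ) (hw : ∑ i, w i = 1) :
    ∑ i, w i * (a i) ^ 2 - (∑ i, w i * a i) ^ 2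
      = ∑ i, w i * (a i - ∑ j, w j * a j) ^ 2 := by
  set m := ∑ j, w j * a j with hm
  have : ∀ i, w i * (a i - m) ^ 2 = w i * a i ^ 2 - 2 * m * (w i * a i) + m ^ 2 * w i := by
    intro i; ring
  simp_rw [this, Finset.sum_add_distrib, Finset.sum_sub_distrib, ← Finset.mul_sum, hw, ← hm]
  ring

/-- At each `x`, `conv μ f x` is the `μ`-mean of `f (x * g⁻¹)`; the loss of norm is the sum of the
corresponding variances. -/
lemma sum_sq_sub_sum_conv_sq (μ : PMF G) (f : G → ℝ) :
    ∑ x, f x ^ 2 - ∑ x, conv μ f x ^ 2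
      = ∑ x, ∑ g, (μ g).toReal * (f (x * g⁻¹) - conv μ f x) ^ 2 := by
  have h1 : ∑ x, f x ^ 2 = ∑ x, ∑ g, (μ g).toReal * f (x * g⁻¹) ^ 2 := by
    rw [Finset.sum_comm]
    simp_rw [← Finset.mul_sum, sum_comp_mul_right (fun x => f x ^ 2), ← Finset.sum_mul,
      sum_pmf_toReal, one_mul]
  rw [h1, ← Finset.sum_sub_distrib]
  exact Finset.sum_congr rfl fun x _ =>
    sum_weighted_variance (fun g => (μ g).toReal) (fun g => f (x * g⁻¹)) (sum_pmf_toReal μ)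

lemma sum_conv_sq_le (μ : PMF G) (f : G → ℝ) : ∑ x, conv μ f x ^ 2 ≤ ∑ x, f x ^ 2 := by
  rw [← sub_nonneg, sum_sq_sub_sum_conv_sq]
  positivity

/-- If no norm is lost, all variances vanish, so `f (x * g⁻¹)` does not depend on `g ∈ Γ`. Then `f`
is right-invariant under `ΓΓ⁻¹`, hence constant, hence zero. -/
lemma sum_conv_sq_lt {μ : PMF G} (hμ : Subgroup.closure (μ.support * μ.support⁻¹) = ⊤)
    {f : G → ℝ} (hf : ∑ x, f x = 0) (hf0 : f ≠ 0) :
    ∑ x, conv μ f x ^ 2 < ∑ x, f x ^ 2 := by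
  refine lt_of_le_of_ne (sum_conv_sq_le μ f) fun heq => hf0 ?_
  have h0 : ∑ x, ∑ g, (μ g).toReal * (f (x * g⁻¹) - conv μ f x) ^ 2 = 0 := by
    rw [← sum_sq_sub_sum_conv_sq, heq, sub_self]
  have h1 : ∀ x, ∀ g ∈ μ.support, f (x * g⁻¹) = conv μ f x := by
    intro x g hg
    have h2 := (Finset.sum_eq_zero_iff_of_nonneg fun x _ => by positivity).1 h0 x (Finset.mem_univ x)
    have h3 := (Finset.sum_eq_zero_iff_of_nonneg fun x _ => by positivity).1 h2 g (Finset.mem_univ g)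
    have hpos : (μ g).toReal ≠ 0 :=
      ENNReal.toReal_ne_zero.2 ⟨(PMF.mem_support_iff _ _).1 hg, μ.apply_ne_top g⟩
    have := (mul_eq_zero.1 h3).resolve_left hpos
    exact sub_eq_zero.1 (pow_eq_zero_iff two_ne_zero |>.1 this)
  have h2 : ∀ a ∈ Subgroup.closure (μ.support * μ.support⁻¹), ∀ x, f (x * a) = f x := by
    intro a ha
    induction ha using Subgroup.closure_induction with
    | mem a ha =>
      obtain ⟨g, hg, k, hk, rfl⟩ := ha
      intro x
      have e1 := h1 (x * g) g hg
      have e2 := h1 (x * g) k⁻¹ hk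
      simp only [mul_inv_cancel_right, inv_inv] at e1 e2
      simp only
      rw [← mul_assoc, e2, e1]
    | one => simp
    | mul a b _ _ iha ihb => intro x; rw [← mul_assoc, ihb, iha]
    | inv a _ ih => intro x; rw [← ih (x * a⁻¹), inv_mul_cancel_right]
  have h3 : ∀ x, f x = f 1 := fun x => by
    have := h2 x (hμ ▸ Subgroup.mem_top x) 1
    rwa [one_mul] at this
  have h4 : (Fintype.card G : ℝ) * f 1 = 0 := by
    rw [← hf, Finset.sum_congr rfl fun x _ => h3 x]
    simp
  have h5 : f 1 = 0 := (mul_eq_zero.1 h4).resolve_left (by simp)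
  ext x
  rw [h3 x, h5, Pi.zero_apply]

/-- Strict contraction of mean-zero functions under right convolution with `μ`. -/
lemma exists_conv_contraction {μ : PMF G} (hμ : Subgroup.closure (μ.support * μ.support⁻¹) = ⊤) :
    ∃ t : ℝ, 0 < t ∧ t ≤ 1 ∧ ∀ f : G → ℝ, ∑ x, f x = 0 →
      ∑ x, conv μ f x ^ 2 ≤ Real.exp (-t) ^ 2 * ∑ x, f x ^ 2 := by
  set K : Set (G → ℝ) := {f | ∑ x, f x = 0 ∧ ∑ x, f x ^ 2 = 1} with hK
  have hcont : Continuous fun f : G → ℝ => ∑ x, conv μ f x ^ 2 := by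
    unfold conv; fun_prop
  have hcomp : IsCompact K := by
    refine Metric.isCompact_of_isClosed_isBounded ?_ ?_
    · exact (isClosed_eq (by fun_prop) continuous_const).inter
        (isClosed_eq (by fun_prop) continuous_const)
    · refine (Metric.isBounded_closedBall (x := (0 : G → ℝ)) (r := 1)).subset fun f hf => ?_
      rw [mem_closedBall_zero_iff, pi_norm_le_iff_of_nonneg zero_le_one]
      intro x
      rw [Real.norm_eq_abs, ← sq_le_one_iff_abs_le_one, ← hf.2]
      exact Finset.single_le_sum (f := fun x => f x ^ 2) (fun _ _ => sq_nonneg _)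
        (Finset.mem_univ x)
  have hc : ∃ c : ℝ, c < 1 ∧ ∀ f ∈ K, ∑ x, conv μ f x ^ 2 ≤ c := by
    rcases K.eq_empty_or_nonempty with hE | hne
    · exact ⟨0, one_pos, by simp [hE]⟩
    · obtain ⟨f, hf, hmax⟩ := hcomp.exists_isMaxOn hne hcont.continuousOn
      refine ⟨_, ?_, fun g hg => hmax hg⟩
      have := sum_conv_sq_lt hμ hf.1 (by rintro rfl; simpa using hf.2)
      rwa [hf.2] at this
  obtain ⟨c, hc1, hc⟩ := hc
  have ht : ∃ t : ℝ, 0 < t ∧ t ≤ 1 ∧ c ≤ Real.exp (-t) ^ 2 := by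
    -- With `t ≤ (1 - c) / 2`, `exp (-2t) ≥ 1 - 2t ≥ c`. The cap at `1` is for the moment estimate,
    -- which linearizes `exp` on `[0, 1]`.
    refine ⟨min 1 ((1 - c) / 2), by positivity [sub_pos.2 hc1], min_le_left _ _, ?_⟩
    have h1 := Real.add_one_le_exp (2 * -min 1 ((1 - c) / 2))
    have h2 := min_le_right 1 ((1 - c) / 2)
    rw [← Real.exp_nat_mul]
    push_cast
    linarith
  obtain ⟨t, ht0, ht1, htc⟩ := ht
  refine ⟨t, ht0, ht1, fun f hf => ?_⟩
  by_cases hs : ∑ x, f x ^ 2 = 0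
  · rw [hs, mul_zero, ← hs]; exact sum_conv_sq_le μ f
  · have hspos : 0 < ∑ x, f x ^ 2 := lt_of_le_of_ne (by positivity) (Ne.symm hs)
    set s := ∑ x, f x ^ 2 with hsd
    have hsq : (√s)⁻¹ ^ 2 = s⁻¹ := by rw [inv_pow, Real.sq_sqrt hspos.le]
    have hscale := hc (fun x => (√s)⁻¹ * f x)
      ⟨by rw [← Finset.mul_sum, hf, mul_zero],
        by simp_rw [mul_pow, ← Finset.mul_sum, hsq, ← hsd]; exact inv_mul_cancel₀ hs⟩
    have hlin : ∀ x, conv μ (fun x => (√s)⁻¹ * f x) x = (√s)⁻¹ * conv μ f x := fun x => by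
      simp only [conv, Finset.mul_sum]
      exact Finset.sum_congr rfl fun g _ => by ring
    simp_rw [hlin, mul_pow, ← Finset.mul_sum, hsq] at hscale
    rw [inv_mul_le_iff₀ hspos] at hscale
    nlinarith

end Contraction

/-! ### Isolated times and steps for fixed flags and indices -/

section Combinatorics

/-- The times `j ∈ {1, …, n}` whose step is fresh and has not been repeated up to time `n`, for
reinforcement flags `e` and indices `k`. -/
def isolated (e : ℕ → Bool) (k : ℕ → ℕ) : ℕ → Finset ℕ
  | 0 => ∅
  | 1 => {1}
  | n + 2 => if e (n + 2) = true then (isolated e k (n + 1)).erase (k (n + 2))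
      else insert (n + 2) (isolated e k (n + 1))

/-- The steps generated by the flags `e`, the indices `k` and the fresh samples `y`. -/
def stepOf {G : Type*} (e : ℕ → Bool) (k : ℕ → ℕ) (y : ℕ → G) (j : ℕ) : G :=
  if _h : 2 ≤ j ∧ e j = true ∧ k j < j then stepOf e k y (k j) else y j
termination_by j
decreasing_by exact _h.2.2

variable {G : Type*} {e : ℕ → Bool} {k : ℕ → ℕ}

lemma isolated_succ {n : ℕ} (hn : 1 ≤ n) :
    isolated e k (n + 1) = if e (n + 1) = true then (isolated e k n).erase (k (n + 1))
      else insert (n + 1) (isolated e k n) := by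
  obtain ⟨m, rfl⟩ := Nat.exists_eq_add_of_le' hn
  rw [isolated]

lemma isolated_subset (n : ℕ) : isolated e k n ⊆ Finset.Icc 1 n := by
  rcases Nat.eq_zero_or_pos n with rfl | hn
  · simp [isolated]
  induction n, hn using Nat.le_induction with
  | base => simp [isolated]
  | succ n hn ih =>
    rw [isolated_succ hn]
    have h1 : isolated e k n ⊆ Finset.Icc 1 (n + 1) :=
      ih.trans (Finset.Icc_subset_Icc_right n.le_succ)
    split_ifs
    · exact (Finset.erase_subset _ _).trans h1
    · exact Finset.insert_subset (by simp) h1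

lemma stepOf_of_fresh {y : ℕ → G} {j : ℕ} (h : e j = false) : stepOf e k y j = y j := by
  rw [stepOf, dif_neg (by simp [h])]

lemma stepOf_of_reinforced {y : ℕ → G} {j : ℕ} (hj : 2 ≤ j) (h : e j = true) (hk : k j < j) :
    stepOf e k y j = stepOf e k y (k j) := by
  rw [stepOf, dif_pos ⟨hj, h, hk⟩]

lemma stepOf_one {y : ℕ → G} : stepOf e k y 1 = y 1 := by
  rw [stepOf, dif_neg (by simp)]

lemma stepOf_of_mem_isolated {y : ℕ → G} {n j : ℕ} (hj : j ∈ isolated e k n) :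
    stepOf e k y j = y j := by
  rcases Nat.eq_zero_or_pos n with rfl | hn
  · simp [isolated] at hj
  induction n, hn using Nat.le_induction with
  | base =>
    obtain rfl : j = 1 := by simpa [isolated] using hj
    exact stepOf_one
  | succ n hn ih =>
    rw [isolated_succ hn] at hj
    split_ifs at hj with he
    · exact ih (Finset.mem_of_mem_erase hj)
    · rcases Finset.mem_insert.1 hj with rfl | hj
      · exact stepOf_of_fresh (by simpa using he)
      · exact ih hj

/-- The steps at the non-isolated times depend only on the samples at the non-isolated times. -/
lemma stepOf_congr_of_notMem_isolated (hk : ∀ j, 2 ≤ j → k j ∈ Finset.Icc 1 (j - 1))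
    {y y' : ℕ → G} {n : ℕ}
    (hy : ∀ j ∈ Finset.Icc 1 n, j ∉ isolated e k n → y j = y' j)
    {j : ℕ} (hj : j ∈ Finset.Icc 1 n) (hj' : j ∉ isolated e k n) :
    stepOf e k y j = stepOf e k y' j := by
  rcases Nat.eq_zero_or_pos n with rfl | hn
  · simp at hj
  induction n, hn using Nat.le_induction generalizing j with
  | base =>
    obtain rfl : j = 1 := by simpa using hj
    simp [isolated] at hj'
  | succ n hn ih =>
    have hkn := Finset.mem_Icc.1 (hk (n + 1) (by omega))
    rw [Finset.mem_Icc] at hj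
    rw [isolated_succ hn] at hy hj'
    split_ifs at hy hj' with he
    · have ih' := fun {i} => @ih (fun i hi hi' => hy i
        (Finset.Icc_subset_Icc_right n.le_succ hi) fun h => hi' (Finset.mem_of_mem_erase h)) i
      -- The one new case is the time being copied: it was isolated, so its step is its own sample,
      -- and it no longer is, so `y` and `y'` agree there.
      have hmain : ∀ i ∈ Finset.Icc 1 n, i ∉ (isolated e k n).erase (k (n + 1)) →
          stepOf e k y i = stepOf e k y' i := by
        intro i hi hi'
        by_cases hmem : i ∈ isolated e k n
        · rw [stepOf_of_mem_isolated hmem, stepOf_of_mem_isolated hmem]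
          exact hy i (Finset.Icc_subset_Icc_right n.le_succ hi) hi'
        · exact ih' hi hmem
      rcases hj.2.eq_or_lt with rfl | hlt
      · rw [stepOf_of_reinforced (by omega) he (by omega),
          stepOf_of_reinforced (by omega) he (by omega)]
        exact hmain _ (Finset.mem_Icc.2 (by omega)) (by simp)
      · exact hmain j (Finset.mem_Icc.2 (by omega)) hj'
    · rw [Finset.mem_insert, not_or] at hj'
      refine ih (fun i hi hi' => hy i (Finset.Icc_subset_Icc_right n.le_succ hi) ?_)
        (Finset.mem_Icc.2 (by omega)) hj'.2
      rw [Finset.mem_insert, not_or]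
      exact ⟨by have := (Finset.mem_Icc.1 hi).2; omega, hi'⟩

end Combinatorics

/-! ### Measurability and integration of discrete random variables -/

section FiniteRange

variable {Ω : Type*} {α β : Type*}

/-- All preimages under `f` are measurable with respect to `m`. -/
def AllMeasurable (m : MeasurableSpace Ω) (f : Ω → α) : Prop :=
  ∀ s : Set α, MeasurableSet[m] (f ⁻¹' s)

variable {m : MeasurableSpace Ω}

lemma AllMeasurable.of_fibers [Countable α] {f : Ω → α}
    (h : ∀ a, MeasurableSet[m] {ω | f ω = a}) : AllMeasurable m f := by
  intro s
  have : f ⁻¹' s = ⋃ a ∈ s, {ω | f ω = a} := by ext; simp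
  rw [this]
  exact MeasurableSet.biUnion s.to_countable fun a _ => h a

lemma AllMeasurable.const (a : α) : AllMeasurable m fun _ : Ω => a := fun s => by
  by_cases h : a ∈ s <;> simp [h]

lemma AllMeasurable.comp {f : Ω → α} (hf : AllMeasurable m f) (φ : α → β) :
    AllMeasurable m fun ω => φ (f ω) := fun s => hf (φ ⁻¹' s)

/-- Splitting over the countably many values of `f` handles evaluation at a random index, such as
the step at time `u n`. -/
lemma AllMeasurable.bind [Countable α] {f : Ω → α} (hf : AllMeasurable m f) {g : α → Ω → β}
    (hg : ∀ a, AllMeasurable m (g a)) : AllMeasurable m fun ω => g (f ω) ω := by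
  intro s
  have : (fun ω => g (f ω) ω) ⁻¹' s = ⋃ a, f ⁻¹' {a} ∩ g a ⁻¹' s := by ext; simp
  rw [this]
  exact MeasurableSet.iUnion fun a => (hf {a}).inter (hg a s)

lemma AllMeasurable.map₂ {γ : Type*} [Countable α] {f : Ω → α} {g : Ω → β}
    (hf : AllMeasurable m f) (hg : AllMeasurable m g) (φ : α → β → γ) :
    AllMeasurable m fun ω => φ (f ω) (g ω) :=
  hf.bind (g := fun a ω => φ a (g ω)) fun a => hg.comp (φ a)

lemma AllMeasurable.pi {ι : Type*} [Finite ι] [Finite α] {f : ι → Ω → α}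
    (hf : ∀ i, AllMeasurable m (f i)) : AllMeasurable m fun ω i => f i ω := by
  refine AllMeasurable.of_fibers fun a => ?_
  have : {ω | (fun i => f i ω) = a} = ⋂ i, f i ⁻¹' {a i} := by ext; simp [funext_iff]
  rw [this]
  exact MeasurableSet.iInter fun i => hf i {a i}

lemma AllMeasurable.isolated {e : ℕ → Ω → Bool} {k : ℕ → Ω → ℕ} {n : ℕ}
    (he : ∀ j, 2 ≤ j → j ≤ n → AllMeasurable m (e j))
    (hk : ∀ j, 2 ≤ j → j ≤ n → AllMeasurable m (k j)) :
    AllMeasurable m fun ω => isolated (fun j => e j ω) (fun j => k j ω) n := by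
  rcases Nat.eq_zero_or_pos n with rfl | hn
  · simpa only [SRRW.isolated] using AllMeasurable.const _
  induction n, hn using Nat.le_induction with
  | base => simpa only [SRRW.isolated] using AllMeasurable.const _
  | succ n hn ih =>
    have ih' := ih (fun j h h' => he j h (by omega)) fun j h h' => hk j h (by omega)
    simp_rw [isolated_succ hn]
    exact (he (n + 1) (by omega) le_rfl).bind
      (g := fun b ω => if b = true then (SRRW.isolated (fun j => e j ω) (fun j => k j ω) n).erase
        (k (n + 1) ω) else insert (n + 1) (SRRW.isolated (fun j => e j ω) (fun j => k j ω) n))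
      fun b => (hk (n + 1) (by omega) le_rfl).map₂ ih'
        fun i A => if b = true then A.erase i else insert (n + 1) A

lemma AllMeasurable.stepOf {G : Type*} [Countable G] {e : ℕ → Ω → Bool} {k : ℕ → Ω → ℕ}
    {y : ℕ → Ω → G} {n : ℕ}
    (he : ∀ j, 2 ≤ j → j ≤ n → AllMeasurable m (e j))
    (hk : ∀ j, 2 ≤ j → j ≤ n → AllMeasurable m (k j))
    (hy : ∀ j, 1 ≤ j → j ≤ n → AllMeasurable m (y j)) {j : ℕ} (hj1 : 1 ≤ j) (hjn : j ≤ n)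
    (hmem : ∀ ω, ∀ i, 2 ≤ i → k i ω ∈ Finset.Icc 1 (i - 1)) :
    AllMeasurable m fun ω => stepOf (fun j => e j ω) (fun j => k j ω) (fun j => y j ω) j := by
  induction j using Nat.strong_induction_on with
  | _ j ih =>
    by_cases hj : 2 ≤ j
    -- The random index is replaced by a fixed `i`, so that the induction hypothesis applies; the
    -- default `y j` for `i` out of range is never attained.
    · have hfun : (fun ω => SRRW.stepOf (fun j => e j ω) (fun j => k j ω) (fun j => y j ω) j) =
          fun ω => (fun i ω => bif e j ω then (if 1 ≤ i ∧ i < j then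
            SRRW.stepOf (fun j => e j ω) (fun j => k j ω) (fun j => y j ω) i else y j ω)
            else y j ω) (k j ω) ω := by
        ext ω
        have := Finset.mem_Icc.1 (hmem ω j hj)
        cases hb : e j ω
        · simp [stepOf_of_fresh (e := fun j => e j ω) hb, hb]
        · rw [stepOf_of_reinforced (e := fun j => e j ω) hj hb (by omega)]
          simp only [hb, cond_true]
          rw [if_pos (by omega)]
      rw [hfun]
      refine (hk j hj hjn).bind (g := fun i ω => bif e j ω then (if 1 ≤ i ∧ i < j then
          SRRW.stepOf (fun j => e j ω) (fun j => k j ω) (fun j => y j ω) i else y j ω)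
          else y j ω) fun i => ?_
      by_cases hi : 1 ≤ i ∧ i < j
      · simp only [if_pos hi]
        exact (he j hj hjn).bind (g := fun b ω => bif b then
          SRRW.stepOf (fun j => e j ω) (fun j => k j ω) (fun j => y j ω) i else y j ω)
          fun b => (ih i hi.2 hi.1 (by omega)).map₂ (hy j hj1 hjn) fun a c => bif b then a else c
      · simp only [if_neg hi, Bool.cond_self]
        exact hy j hj1 hjn
    · obtain rfl : j = 1 := by omega
      simpa only [stepOf_one] using hy 1 le_rfl hjn

variable {P : Measure Ω} [IsProbabilityMeasure P]

lemma measureReal_eq_sum_fibers {V : Ω → α} (hV : AllMeasurable m V) (F : Finset α)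
    (hF : ∀ ω, V ω ∈ F) (E : Set Ω) : P.real E = ∑ v ∈ F, P.real (E ∩ {ω | V ω = v}) := by
  have h := sum_measureReal_preimage_singleton (μ := P.restrict E) F (f := V)
    fun y _ => hV {y}
  have h2 : V ⁻¹' (F : Set α) = Set.univ := by ext; simp [hF]
  rw [h2, measureReal_restrict_apply MeasurableSet.univ, Set.univ_inter] at h
  rw [← h]
  refine Finset.sum_congr rfl fun v _ => ?_
  rw [measureReal_restrict_apply (hV {v}), Set.inter_comm]
  rfl

lemma integral_comp_eq_sum {V : Ω → α} (hV : AllMeasurable m V) (F : Finset α)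
    (hF : ∀ ω, V ω ∈ F) (φ : α → ℝ) :
    ∫ ω, φ (V ω) ∂P = ∑ v ∈ F, P.real {ω | V ω = v} * φ v := by
  classical
  have h : (fun ω => φ (V ω)) = fun ω => ∑ v ∈ F, (V ⁻¹' {v}).indicator (fun _ => φ v) ω := by
    ext ω
    rw [Finset.sum_eq_single (V ω)]
    · simp
    · intro v _ hv
      exact Set.indicator_of_notMem (fun h => hv (by simpa using h.symm)) _
    · exact fun h => absurd (hF ω) h
  rw [h, integral_finsetSum _ fun v _ => (integrable_const (φ v)).indicator (hV {v})]
  refine Finset.sum_congr rfl fun v _ => ?_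
  rw [integral_indicator_const _ (hV {v}), smul_eq_mul]
  rfl

lemma integrable_comp {V : Ω → α} (hV : AllMeasurable m V) (F : Finset α)
    (hF : ∀ ω, V ω ∈ F) (φ : α → ℝ) : Integrable (fun ω => φ (V ω)) P := by
  have hmeas : Measurable fun ω => φ (V ω) := fun s _ => hV (φ ⁻¹' s)
  refine Integrable.of_bound hmeas.aestronglyMeasurable (∑ v ∈ F, |φ v|) ?_
  exact ae_of_all _ fun ω => Finset.single_le_sum (f := fun v => |φ v|)
    (fun _ _ => abs_nonneg _) (hF ω)

lemma integral_comp_mono {V : Ω → α} (hV : AllMeasurable m V) (F : Finset α)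
    (hF : ∀ ω, V ω ∈ F) (φ ψ : α → ℝ) (h : ∀ a ∈ F, φ a ≤ ψ a) :
    ∫ ω, φ (V ω) ∂P ≤ ∫ ω, ψ (V ω) ∂P :=
  integral_mono (integrable_comp hV F hF φ) (integrable_comp hV F hF ψ) fun ω => h _ (hF ω)

end FiniteRange

/-! ### Products with some random and some deterministic factors -/

section Prefix

variable {G : Type*} [Group G]

/-- The product `z 1 * ⋯ * z n`. -/
def prefixProd (z : ℕ → G) : ℕ → G
  | 0 => 1
  | n + 1 => prefixProd z n * z (n + 1)

lemma prefixProd_congr {z z' : ℕ → G} {n : ℕ} (h : ∀ j ∈ Finset.Icc 1 n, z j = z' j) :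
    prefixProd z n = prefixProd z' n := by
  induction n with
  | zero => rfl
  | succ n ih =>
    rw [prefixProd, prefixProd, ih fun j hj => h j (Finset.Icc_subset_Icc_right n.le_succ hj),
      h (n + 1) (by simp)]

lemma AllMeasurable.prefixProd [Countable G] {Ω : Type*} {m : MeasurableSpace Ω} {z : ℕ → Ω → G}
    {n : ℕ} (hz : ∀ j ∈ Finset.Icc 1 n, AllMeasurable m (z j)) :
    AllMeasurable m fun ω => prefixProd (fun j => z j ω) n := by
  induction n with
  | zero => exact AllMeasurable.const 1
  | succ n ih =>
    exact (ih fun j hj => hz j (Finset.Icc_subset_Icc_right n.le_succ hj)).map₂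
      (hz (n + 1) (by simp)) (· * ·)

variable [Fintype G] {Ω : Type*} {mΩ : MeasurableSpace Ω} {P : Measure Ω} [IsProbabilityMeasure P]

/-- If, on the event `B`, the steps at the times in `A` are successively independent with law `μ`
and the others are deterministic, then the walk is exponentially close to uniform in `|A|`. -/
lemma abs_measureReal_prefixProd_sub_le {μ : PMF G} {t : ℝ}
    (ht : ∀ f : G → ℝ, ∑ x, f x = 0 →
      ∑ x, conv μ f x ^ 2 ≤ Real.exp (-t) ^ 2 * ∑ x, f x ^ 2)
    {Y : ℕ → Ω → G} (hY : ∀ j, 1 ≤ j → AllMeasurable mΩ (Y j)) (B : Set Ω) (A : Finset ℕ)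
    (g : ℕ → G) {n : ℕ} (hA : A ⊆ Finset.Icc 1 n)
    (hind : ∀ i, i + 1 ∈ A → ∀ x a, P.real (B ∩ {ω | prefixProd
      (fun j => if j ∈ A then Y j ω else g j) i = x} ∩ {ω | Y (i + 1) ω = a}) =
        P.real (B ∩ {ω | prefixProd (fun j => if j ∈ A then Y j ω else g j) i = x}) *
          (μ a).toReal) (x : G) :
    |P.real (B ∩ {ω | prefixProd (fun j => if j ∈ A then Y j ω else g j) n = x})
      - P.real B / Fintype.card G| ≤ P.real B * Real.exp (-t) ^ A.card := by
  classical
  set z : Ω → ℕ → G := fun ω j => if j ∈ A then Y j ω else g j with hz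
  set b := P.real B with hb
  have hb0 : 0 ≤ b := measureReal_nonneg
  have hcard : (0 : ℝ) < Fintype.card G := by exact_mod_cast Fintype.card_pos
  have hpref : ∀ i, AllMeasurable mΩ fun ω => prefixProd (z ω) i := fun i =>
    AllMeasurable.prefixProd (z := fun j ω => z ω j) fun j hj => by
      by_cases hjA : j ∈ A
      · simpa only [hz, if_pos hjA] using hY j (Finset.mem_Icc.1 hj).1
      · simpa only [hz, if_neg hjA] using AllMeasurable.const _
  set q : ℕ → G → ℝ := fun i x => P.real (B ∩ {ω | prefixProd (z ω) i = x}) with hq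
  have hqsum : ∀ i, ∑ x, q i x = b := fun i =>
    (measureReal_eq_sum_fibers (hpref i) Finset.univ (fun _ => Finset.mem_univ _) B).symm
  have hfsum : ∀ i, ∑ x, (q i x - b / Fintype.card G) = 0 := by
    intro i
    rw [Finset.sum_sub_distrib, hqsum, Finset.sum_const, Finset.card_univ, nsmul_eq_mul,
      mul_div_cancel₀ _ hcard.ne', sub_self]
  -- The laws are restricted to `B`, not normalized, so they have mass `b` and null events need no
  -- separate treatment.
  have hmain : ∀ i, ∑ x, (q i x - b / Fintype.card G) ^ 2 ≤
      b ^ 2 * (Real.exp (-t) ^ 2) ^ (A.filter (· ≤ i)).card := by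
    intro i
    induction i with
    | zero =>
      have hA0 : A.filter (· ≤ 0) = ∅ := by
        refine Finset.filter_eq_empty_iff.2 fun j hj => ?_
        have := (Finset.mem_Icc.1 (hA hj)).1
        omega
      have hq0 : ∀ x, q 0 x = if x = 1 then b else 0 := by
        intro x
        by_cases hx : x = 1
        · simp [hq, hx, prefixProd, hb]
        · simp [hq, hx, prefixProd, Ne.symm hx]
      have e1 : ∀ x, (q 0 x - b / Fintype.card G) ^ 2 =
          (if x = 1 then b ^ 2 else 0) - 2 * (b / Fintype.card G) * q 0 x
            + (b / Fintype.card G) ^ 2 := by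
        intro x
        rw [hq0]
        split_ifs <;> ring
      rw [hA0, Finset.card_empty, pow_zero, mul_one]
      simp_rw [e1]
      rw [Finset.sum_add_distrib, Finset.sum_sub_distrib, ← Finset.mul_sum, hqsum,
        Finset.sum_ite_eq' Finset.univ (1 : G), if_pos (Finset.mem_univ _), Finset.sum_const,
        Finset.card_univ, nsmul_eq_mul]
      have e2 : b ^ 2 - 2 * (b / Fintype.card G) * b
          + Fintype.card G * (b / Fintype.card G) ^ 2 = b ^ 2 - b ^ 2 / Fintype.card G := by
        field_simp
        ring
      rw [e2]
      have : 0 ≤ b ^ 2 / Fintype.card G := by positivity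
      linarith
    | succ i ih =>
      by_cases hi : i + 1 ∈ A
      · have hstep : ∀ x, q (i + 1) x = conv μ (q i) x := by
          intro x
          have h1 := measureReal_eq_sum_fibers (P := P) (hY (i + 1) (by omega)) Finset.univ
            (fun _ => Finset.mem_univ _) (B ∩ {ω | prefixProd (z ω) (i + 1) = x})
          simp only [hq] at h1 ⊢
          rw [h1, conv]
          refine Finset.sum_congr rfl fun a _ => ?_
          rw [mul_comm, ← hind i hi (x * a⁻¹) a]
          congr 1
          ext ω
          simp only [Set.mem_inter_iff, Set.mem_ofPred_eq, prefixProd, hz, if_pos hi,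
            eq_mul_inv_iff_mul_eq, and_assoc]
          refine and_congr_right fun _ => and_congr_left ?_
          rintro rfl
          rfl
        have hcardi : (A.filter (· ≤ i + 1)).card = (A.filter (· ≤ i)).card + 1 := by
          rw [← Finset.card_insert_of_notMem (a := i + 1) (by simp)]
          congr 1
          ext j
          simp only [Finset.mem_filter, Finset.mem_insert]
          constructor
          · rintro ⟨h1, h2⟩
            rcases h2.eq_or_lt with rfl | h2
            · exact Or.inl rfl
            · exact Or.inr ⟨h1, by omega⟩
          · rintro (rfl | ⟨h1, h2⟩)
            · exact ⟨hi, le_rfl⟩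
            · exact ⟨h1, by omega⟩
        simp_rw [hstep, ← conv_const μ (q i)]
        refine (ht _ (hfsum i)).trans ?_
        rw [hcardi, pow_succ]
        calc _ ≤ Real.exp (-t) ^ 2 * (b ^ 2 * (Real.exp (-t) ^ 2) ^ (A.filter (· ≤ i)).card) :=
              mul_le_mul_of_nonneg_left ih (by positivity)
          _ = _ := by ring
      -- A deterministic factor only translates the law, which leaves the sum of squares unchanged.
      · have hstep : ∀ x, q (i + 1) x = q i (x * (g (i + 1))⁻¹) := by
          intro x
          simp only [hq, prefixProd, hz, if_neg hi, eq_mul_inv_iff_mul_eq]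
        have hfilter : A.filter (· ≤ i + 1) = A.filter (· ≤ i) := by
          refine Finset.filter_congr fun j hj => ?_
          have : j ≠ i + 1 := by rintro rfl; exact hi hj
          omega
        simp_rw [hstep]
        rw [hfilter, sum_comp_mul_right fun x => (q i x - b / Fintype.card G) ^ 2]
        exact ih
  have hAn : A.filter (· ≤ n) = A :=
    Finset.filter_true_of_mem fun j hj => (Finset.mem_Icc.1 (hA hj)).2
  have h1 := (Finset.single_le_sum (f := fun x => (q n x - b / Fintype.card G) ^ 2)
    (fun _ _ => sq_nonneg _) (Finset.mem_univ x)).trans (hmain n)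
  rw [hAn, ← pow_mul, mul_comm 2, pow_mul, ← mul_pow] at h1
  exact abs_le_of_sq_le_sq h1 (by positivity)

end Prefix

/-! ### One step of the exponential moment -/

section MomentBound

lemma exp_neg_card_erase (t : ℝ) (A : Finset ℕ) (k : ℕ) :
    Real.exp (-t * (A.erase k).card) =
      Real.exp (-t * A.card) * (1 + if k ∈ A then Real.exp t - 1 else 0) := by
  split_ifs with h
  · have : ((A.erase k).card : ℝ) = A.card - 1 := by
      rw [← Finset.card_erase_add_one h]; push_cast; ring
    rw [this, add_sub_cancel, ← Real.exp_add]
    congr 1; ring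
  · rw [Finset.erase_eq_of_notMem h, add_zero, mul_one]

/-- One-step estimate for the exponential moment of the number of isolated times. -/
lemma exp_moment_transition_le {α t : ℝ} (hα1 : α ≤ 1) (ht0 : 0 ≤ t) (ht1 : t ≤ 1)
    {n : ℕ} (hn : 1 ≤ n) {A : Finset ℕ} (hA : A ⊆ Finset.Icc 1 n) :
    (1 - α) * Real.exp (-t * (insert (n + 1) A).card) +
      α * ((n : ℝ)⁻¹ * ∑ k ∈ Finset.Icc 1 n, Real.exp (-t * (A.erase k).card)) ≤
    Real.exp (-((1 - α) * t / 2)) * Real.exp (-(t * (n - 2) / n) * A.card) := by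
  have hn0 : (0 : ℝ) < n := by exact_mod_cast hn
  have hnotMem : n + 1 ∉ A := fun h => by simpa using hA h
  have hsum : ∑ k ∈ Finset.Icc 1 n, Real.exp (-t * (A.erase k).card) =
      Real.exp (-t * A.card) * (n + A.card * (Real.exp t - 1)) := by
    simp_rw [exp_neg_card_erase, ← Finset.mul_sum, Finset.sum_add_distrib]
    rw [← Finset.sum_filter, Finset.filter_mem_eq_inter, Finset.inter_eq_right.2 hA]
    simp
    ring
  have hinsert : Real.exp (-t * (insert (n + 1) A).card) =
      Real.exp (-t * A.card) * Real.exp (-t) := by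
    rw [Finset.card_insert_of_notMem hnotMem, ← Real.exp_add]
    congr 1; push_cast; ring
  set r : ℝ := A.card / n with hr
  have hr0 : 0 ≤ r := by positivity
  -- This follows from `(1 - t / 2) * (1 + t) ≥ 1`, valid on `[0, 1]`.
  have h1 : Real.exp (-t) ≤ 1 - t / 2 := by
    rw [Real.exp_neg, inv_le_iff_one_le_mul₀ (Real.exp_pos t)]
    nlinarith [Real.add_one_le_exp t]
  have h2 : Real.exp t - 1 ≤ 2 * t := by
    have := Real.abs_exp_sub_one_le (x := t) (by rwa [abs_of_nonneg ht0])
    rw [abs_of_nonneg ht0] at this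
    exact (le_abs_self _).trans this
  have h3 : 0 ≤ Real.exp t - 1 := by linarith [Real.add_one_le_exp t]
  rw [hsum, hinsert]
  calc _ = Real.exp (-t * A.card) * ((1 - α) * Real.exp (-t) + α * (1 + r * (Real.exp t - 1))) := by
        rw [hr]; field_simp
    -- The factor `α` of the erasure term is bounded by `1`, which keeps the new exponent `t - 2 * t
    -- / n` independent of `α`.
    _ ≤ Real.exp (-t * A.card) * (-((1 - α) * t / 2) + r * (2 * t) + 1) := by
        refine mul_le_mul_of_nonneg_left ?_ (Real.exp_pos _).le
        have e1 := mul_le_mul_of_nonneg_left h1 (sub_nonneg.2 hα1)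
        have e2 := mul_le_mul_of_nonneg_left h2 hr0
        have e3 : α * (r * (Real.exp t - 1)) ≤ 1 * (r * (Real.exp t - 1)) :=
          mul_le_mul_of_nonneg_right hα1 (mul_nonneg hr0 h3)
        linarith
    _ ≤ Real.exp (-t * A.card) * Real.exp (-((1 - α) * t / 2) + r * (2 * t)) := by
        gcongr
        exact Real.add_one_le_exp _
    _ = _ := by
        rw [← Real.exp_add, ← Real.exp_add]
        congr 1
        rw [hr]; field_simp; ring

end MomentBound

/-! ### The random construction and its independence -/

section Construction

variable {G Ω : Type*}

/-- The σ-algebras generated by the flags, the indices and the fresh samples. -/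
@[reducible]
def source (ξ : ℕ → Ω → Bool) (u : ℕ → Ω → ℕ) (Y : ℕ → Ω → G) :
    ℕ ⊕ ℕ ⊕ ℕ → MeasurableSpace Ω :=
  Sum.elim (fun n : ℕ => MeasurableSpace.comap (ξ (n + 2)) ⊤)
    (Sum.elim (fun n : ℕ => MeasurableSpace.comap (u (n + 2)) ⊤)
      (fun n : ℕ => MeasurableSpace.comap (Y (n + 1)) ⊤))

variable {ξ : ℕ → Ω → Bool} {u : ℕ → Ω → ℕ} {Y X S : ℕ → Ω → G}

lemma AllMeasurable.fiber {β : Type*} {m : MeasurableSpace Ω} {f : Ω → β}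
    (hf : AllMeasurable m f) (a : β) :
    MeasurableSet[m] {ω | f ω = a} := hf {a}

lemma allMeasurable_flag {J : Set (ℕ ⊕ ℕ ⊕ ℕ)} {j : ℕ} (hj : 2 ≤ j) (hJ : Sum.inl (j - 2) ∈ J) :
    AllMeasurable (⨆ i ∈ J, source ξ u Y i) (ξ j) := fun s => by
  refine le_biSup (source ξ u Y) hJ _ ⟨s, trivial, ?_⟩
  rw [Nat.sub_add_cancel hj]

lemma allMeasurable_index {J : Set (ℕ ⊕ ℕ ⊕ ℕ)} {j : ℕ} (hj : 2 ≤ j)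
    (hJ : Sum.inr (Sum.inl (j - 2)) ∈ J) :
    AllMeasurable (⨆ i ∈ J, source ξ u Y i) (u j) := fun s => by
  refine le_biSup (source ξ u Y) hJ _ ⟨s, trivial, ?_⟩
  rw [Nat.sub_add_cancel hj]

lemma allMeasurable_fresh {J : Set (ℕ ⊕ ℕ ⊕ ℕ)} {j : ℕ} (hj : 1 ≤ j)
    (hJ : Sum.inr (Sum.inr (j - 1)) ∈ J) :
    AllMeasurable (⨆ i ∈ J, source ξ u Y i) (Y j) := fun s => by
  refine le_biSup (source ξ u Y) hJ _ ⟨s, trivial, ?_⟩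
  rw [Nat.sub_add_cancel hj]

variable [Group G] [mΩ : MeasurableSpace Ω] {P : Measure Ω} {α : ℝ} {μ : PMF G}

namespace IsConstruction

lemma flag_allMeasurable (h : IsConstruction P α μ ξ u Y X S) {j : ℕ} (hj : 2 ≤ j) :
    AllMeasurable mΩ (ξ j) :=
  AllMeasurable.of_fibers (h.measurable_flag j hj)

lemma index_allMeasurable (h : IsConstruction P α μ ξ u Y X S) {j : ℕ} (hj : 2 ≤ j) :
    AllMeasurable mΩ (u j) :=
  AllMeasurable.of_fibers (h.measurable_index j hj)

lemma fresh_allMeasurable (h : IsConstruction P α μ ξ u Y X S) {j : ℕ} (hj : 1 ≤ j) :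
    AllMeasurable mΩ (Y j) :=
  h.measurable_fresh j hj

lemma source_le (h : IsConstruction P α μ ξ u Y X S) (i : ℕ ⊕ ℕ ⊕ ℕ) :
    source ξ u Y i ≤ mΩ := by
  rcases i with n | n | n <;> rintro _ ⟨s, -, rfl⟩
  · exact h.flag_allMeasurable (by omega) s
  · exact h.index_allMeasurable (by omega) s
  · exact h.fresh_allMeasurable (by omega) s

/-- All uses of independence reduce to this form: one source variable against all the others. -/
lemma measureReal_inter (h : IsConstruction P α μ ξ u Y X S) {i : ℕ ⊕ ℕ ⊕ ℕ} {C D : Set Ω}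
    (hC : MeasurableSet[⨆ j ∈ ({i} : Set (ℕ ⊕ ℕ ⊕ ℕ)), source ξ u Y j] C)
    (hD : MeasurableSet[⨆ j ∈ ({i}ᶜ : Set (ℕ ⊕ ℕ ⊕ ℕ)), source ξ u Y j] D) :
    P.real (C ∩ D) = P.real C * P.real D := by
  have hind := indep_iSup_of_disjoint h.source_le h.independent
    (S := {i}) (T := {i}ᶜ) disjoint_compl_right
  rw [measureReal_def, (Indep_iff _ _ _).1 hind C D hC hD, ENNReal.toReal_mul]
  rfl

lemma step_eq (h : IsConstruction P α μ ξ u Y X S) (ω : Ω) {j : ℕ} (hj : 1 ≤ j) :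
    X j ω = stepOf (fun i => ξ i ω) (fun i => u i ω) (fun i => Y i ω) j := by
  induction j using Nat.strong_induction_on with
  | _ j ih =>
    by_cases hj2 : 2 ≤ j
    · have hu := Finset.mem_Icc.1 (h.index_mem j hj2 ω)
      cases hξ : ξ j ω
      · rw [stepOf_of_fresh (e := fun i => ξ i ω) hξ, h.step_fresh j hj2 ω hξ]
      · rw [stepOf_of_reinforced (e := fun i => ξ i ω) hj2 hξ (by omega),
          h.step_reinforced j hj2 ω hξ, ih _ (by omega) (by omega)]
    · obtain rfl : j = 1 := by omega
      rw [stepOf_one, h.step_one]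

lemma walk_eq (h : IsConstruction P α μ ξ u Y X S) (ω : Ω) (n : ℕ) :
    S n ω = prefixProd (fun j => X j ω) n := by
  induction n with
  | zero => exact h.walk_zero ω
  | succ n ih => rw [h.walk_succ, ih, prefixProd]

lemma isolated_allMeasurable (h : IsConstruction P α μ ξ u Y X S) (n : ℕ) :
    AllMeasurable mΩ fun ω => isolated (fun j => ξ j ω) (fun j => u j ω) n :=
  AllMeasurable.isolated (fun _ hj _ => h.flag_allMeasurable hj)
    fun _ hj _ => h.index_allMeasurable hj

lemma measureReal_flag [IsProbabilityMeasure P] (h : IsConstruction P α μ ξ u Y X S)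
    (hα : 0 ≤ α) {j : ℕ} (hj : 2 ≤ j) (b : Bool) :
    P.real {ω | ξ j ω = b} = bif b then α else 1 - α := by
  have ht : P.real {ω | ξ j ω = true} = α := by
    rw [measureReal_def, h.law_flag j hj, ENNReal.toReal_ofReal hα]
  cases b
  · have hc : {ω | ξ j ω = false} = {ω | ξ j ω = true}ᶜ := by ext; simp
    rw [hc, probReal_compl_eq_one_sub (h.measurable_flag j hj true), ht]
    rfl
  · exact ht

/-- The Markov property of the set of isolated times. -/
lemma integral_isolated_succ [IsProbabilityMeasure P] (h : IsConstruction P α μ ξ u Y X S)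
    (hα : 0 ≤ α) {n : ℕ} (hn : 1 ≤ n) (φ : Finset ℕ → ℝ) :
    ∫ ω, φ (isolated (fun j => ξ j ω) (fun j => u j ω) (n + 1)) ∂P =
      ∫ ω, (fun A => (1 - α) * φ (insert (n + 1) A) +
        α * ((n : ℝ)⁻¹ * ∑ k ∈ Finset.Icc 1 n, φ (A.erase k)))
          (isolated (fun j => ξ j ω) (fun j => u j ω) n) ∂P := by
  set I : Ω → Finset ℕ := fun ω => isolated (fun j => ξ j ω) (fun j => u j ω) n with hI
  have hImeas : AllMeasurable mΩ I := h.isolated_allMeasurable n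
  have hIF : ∀ ω, I ω ∈ (Finset.Icc 1 n).powerset := fun ω =>
    Finset.mem_powerset.2 (isolated_subset n)
  set W : Ω → Finset ℕ × Bool × ℕ := fun ω => (I ω, ξ (n + 1) ω, u (n + 1) ω) with hW
  have hWmeas : AllMeasurable mΩ W :=
    hImeas.map₂ ((h.flag_allMeasurable (by omega)).map₂ (h.index_allMeasurable (by omega))
      Prod.mk) Prod.mk
  have hWF : ∀ ω, W ω ∈ (Finset.Icc 1 n).powerset ×ˢ (Finset.univ ×ˢ Finset.Icc 1 n) := by
    intro ω
    have := h.index_mem (n + 1) (by omega) ω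
    rw [Nat.add_sub_cancel] at this
    exact Finset.mem_product.2 ⟨hIF ω, Finset.mem_product.2 ⟨Finset.mem_univ _, this⟩⟩
  set ψ : Finset ℕ × Bool × ℕ → ℝ := fun w => φ (if w.2.1 = true then w.1.erase w.2.2
    else insert (n + 1) w.1) with hψ
  have hlaw : ∀ A, ∀ b, ∀ k ∈ Finset.Icc 1 n, P.real {ω | W ω = (A, b, k)} =
      P.real {ω | I ω = A} * ((bif b then α else 1 - α) * (n : ℝ)⁻¹) := by
    intro A b k hk
    have hset : {ω | W ω = (A, b, k)} =
        {ω | ξ (n + 1) ω = b} ∩ ({ω | u (n + 1) ω = k} ∩ {ω | I ω = A}) := by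
      ext ω; simp [hW]; tauto
    -- The isolated set up to `n` uses flags and indices up to `n` only, so the flag and then the
    -- index at `n + 1` can be split off.
    have hmono : ∀ J : Set (ℕ ⊕ ℕ ⊕ ℕ), (∀ j, 2 ≤ j → j ≤ n → Sum.inl (j - 2) ∈ J ∧
        Sum.inr (Sum.inl (j - 2)) ∈ J) → AllMeasurable (⨆ i ∈ J, source ξ u Y i) I :=
      fun J hJ => AllMeasurable.isolated (fun j h2 hjn => allMeasurable_flag h2 (hJ j h2 hjn).1)
        fun j h2 hjn => allMeasurable_index h2 (hJ j h2 hjn).2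
    have hu : P.real {ω | u (n + 1) ω = k} = (n : ℝ)⁻¹ := by
      rw [measureReal_def, h.law_index (n + 1) (by omega) k (by simpa using hk)]
      simp
    have hfl : AllMeasurable (⨆ i ∈ ({Sum.inl (n + 1 - 2)} : Set (ℕ ⊕ ℕ ⊕ ℕ)),
        source ξ u Y i) (ξ (n + 1)) := allMeasurable_flag (by omega) (by simp)
    have hix : AllMeasurable (⨆ i ∈ ({Sum.inl (n + 1 - 2)}ᶜ : Set (ℕ ⊕ ℕ ⊕ ℕ)),
        source ξ u Y i) (u (n + 1)) := allMeasurable_index (by omega) (by simp)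
    have hix' : AllMeasurable (⨆ i ∈ ({Sum.inr (Sum.inl (n + 1 - 2))} : Set (ℕ ⊕ ℕ ⊕ ℕ)),
        source ξ u Y i) (u (n + 1)) := allMeasurable_index (by omega) (by simp)
    have hI1 : AllMeasurable (⨆ i ∈ ({Sum.inl (n + 1 - 2)}ᶜ : Set (ℕ ⊕ ℕ ⊕ ℕ)),
        source ξ u Y i) I := hmono _ fun j _ _ => ⟨by simp; omega, by simp⟩
    have hI2 : AllMeasurable (⨆ i ∈ ({Sum.inr (Sum.inl (n + 1 - 2))}ᶜ : Set (ℕ ⊕ ℕ ⊕ ℕ)),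
        source ξ u Y i) I := hmono _ fun j _ _ => ⟨by simp, by simp; omega⟩
    rw [hset, h.measureReal_inter (hfl.fiber b) ((hix.fiber k).inter (hI1.fiber A)),
      h.measureReal_inter (hix'.fiber k) (hI2.fiber A), h.measureReal_flag hα (by omega), hu]
    ring
  have h1 : ∀ ω, φ (isolated (fun j => ξ j ω) (fun j => u j ω) (n + 1)) = ψ (W ω) := fun ω => by
    rw [isolated_succ hn]
  have hn0 : (n : ℝ) ≠ 0 := by exact_mod_cast (by omega : n ≠ 0)
  simp_rw [h1]
  rw [integral_comp_eq_sum hWmeas _ hWF ψ, integral_comp_eq_sum hImeas _ hIF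
    (fun A => (1 - α) * φ (insert (n + 1) A) +
      α * ((n : ℝ)⁻¹ * ∑ k ∈ Finset.Icc 1 n, φ (A.erase k))), Finset.sum_product]
  refine Finset.sum_congr rfl fun A _ => ?_
  have h2 : ∀ b : Bool, ∑ k ∈ Finset.Icc 1 n, P.real {ω | W ω = (A, b, k)} * ψ (A, b, k) =
      P.real {ω | I ω = A} * ((bif b then α else 1 - α) *
        ((n : ℝ)⁻¹ * ∑ k ∈ Finset.Icc 1 n, ψ (A, b, k))) := by
    intro b
    rw [Finset.sum_congr rfl fun k hk => by rw [hlaw A b k hk], ← Finset.mul_sum]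
    ring
  rw [Finset.sum_product, Fintype.sum_bool, h2, h2]
  simp only [hψ, cond_true, cond_false, if_true, Bool.false_eq_true, if_false, Finset.sum_const,
    Nat.card_Icc, Nat.add_sub_cancel, nsmul_eq_mul, inv_mul_cancel_left₀ hn0]
  ring

/-- Exponential moments of the number of isolated times. -/
lemma integral_exp_card_isolated_le [IsProbabilityMeasure P]
    (h : IsConstruction P α μ ξ u Y X S) (hα0 : 0 ≤ α) (hα1 : α ≤ 1) {c : ℝ} (hc : 0 ≤ c)
    {n : ℕ} (hn : 1 ≤ n) (hcn : c * ((n - 1) * (n - 2)) ≤ 1) :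
    ∫ ω, Real.exp (-(c * ((n - 1) * (n - 2))) *
        (isolated (fun j => ξ j ω) (fun j => u j ω) n).card) ∂P ≤
      Real.exp (-((1 - α) * (c * (n * (n - 1) * (n - 2)) / 6))) := by
  -- The exponent varies with time: `c * n * (n - 1)` at time `n + 1` becomes `c * (n - 1) * (n -
  -- 2)` at time `n`, and it vanishes at `n = 1`. The gains `c * k * (k - 1) / 2` over `k < n` sum
  -- to `c * n * (n - 1) * (n - 2) / 6`.
  induction n, hn using Nat.le_induction with
  | base => simp
  | succ n hn ih =>
    have hn1 : (1 : ℝ) ≤ n := by exact_mod_cast hn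
    push_cast at hcn ⊢
    have e1 : (n + 1 - 1 : ℝ) * (n + 1 - 2) = n * (n - 1) := by ring
    rw [e1] at hcn ⊢
    have ht0 : 0 ≤ c * (n * (n - 1) : ℝ) :=
      mul_nonneg hc (mul_nonneg (by linarith) (by linarith))
    have hle : c * ((n - 1) * (n - 2) : ℝ) ≤ 1 :=
      (mul_le_mul_of_nonneg_left (by nlinarith) hc).trans hcn
    have ht : c * (n * (n - 1)) * (n - 2) / n = c * ((n - 1) * (n - 2) : ℝ) := by
      field_simp
    rw [h.integral_isolated_succ hα0 hn fun A => Real.exp (-(c * (n * (n - 1))) * A.card)]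
    have hI := h.isolated_allMeasurable n
    have hIF : ∀ ω, isolated (fun j => ξ j ω) (fun j => u j ω) n ∈ (Finset.Icc 1 n).powerset :=
      fun ω => Finset.mem_powerset.2 (isolated_subset n)
    calc _ ≤ ∫ ω, (fun A : Finset ℕ => Real.exp (-((1 - α) * (c * (n * (n - 1))) / 2)) *
          Real.exp (-(c * ((n - 1) * (n - 2))) * A.card))
            (isolated (fun j => ξ j ω) (fun j => u j ω) n) ∂P := by
          refine integral_comp_mono hI _ hIF
            (fun A => (1 - α) * Real.exp (-(c * (n * (n - 1))) * (insert (n + 1) A).card) +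
              α * ((n : ℝ)⁻¹ * ∑ k ∈ Finset.Icc 1 n,
                Real.exp (-(c * (n * (n - 1))) * (A.erase k).card)))
            (fun A => Real.exp (-((1 - α) * (c * (n * (n - 1))) / 2)) *
              Real.exp (-(c * ((n - 1) * (n - 2))) * A.card)) fun A hA => ?_
          have := exp_moment_transition_le hα1 ht0 hcn hn (Finset.mem_powerset.1 hA)
          rwa [ht] at this
      _ = Real.exp (-((1 - α) * (c * (n * (n - 1))) / 2)) * ∫ ω,
          Real.exp (-(c * ((n - 1) * (n - 2))) *
            (isolated (fun j => ξ j ω) (fun j => u j ω) n).card) ∂P := integral_const_mul _ _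
      _ ≤ Real.exp (-((1 - α) * (c * (n * (n - 1))) / 2)) *
          Real.exp (-((1 - α) * (c * (n * (n - 1) * (n - 2)) / 6))) :=
          mul_le_mul_of_nonneg_left (ih hle) (Real.exp_pos _).le
      _ = _ := by
          rw [← Real.exp_add]
          congr 1
          ring

/-- The walk at time `n` is uniform up to an exponential moment of the number of isolated times. -/
lemma abs_measureReal_walk_sub_le [Fintype G] [IsProbabilityMeasure P]
    (h : IsConstruction P α μ ξ u Y X S) {t : ℝ}
    (ht : ∀ f : G → ℝ, ∑ x, f x = 0 →
      ∑ x, conv μ f x ^ 2 ≤ Real.exp (-t) ^ 2 * ∑ x, f x ^ 2) (n : ℕ) (x : G) :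
    |P.real {ω | S n ω = x} - (Fintype.card G : ℝ)⁻¹| ≤
      ∫ ω, Real.exp (-t * (isolated (fun j => ξ j ω) (fun j => u j ω) n).card) ∂P := by
  classical
  set I : Ω → Finset ℕ := fun ω => isolated (fun j => ξ j ω) (fun j => u j ω) n with hI
  have hImeas : AllMeasurable mΩ I := h.isolated_allMeasurable n
  have hIF : ∀ ω, I ω ∈ (Finset.Icc 1 n).powerset := fun ω =>
    Finset.mem_powerset.2 (isolated_subset n)
  -- Samples at times in `A` are overwritten by `1`, so `X' A` does not depend on them; on `I = A`
  -- it still gives the true steps outside `A`.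
  set X' : Finset ℕ → ℕ → Ω → G := fun A j ω => stepOf (fun i => ξ i ω) (fun i => u i ω)
    (fun i => (if i ∈ A then fun _ => 1 else Y i) ω) j with hX'
  have hmem := h.index_mem
  have hX'meas : ∀ (A : Finset ℕ) (m : MeasurableSpace Ω),
      (∀ j, 2 ≤ j → AllMeasurable m (ξ j)) → (∀ j, 2 ≤ j →
      AllMeasurable m (u j)) → (∀ j, 1 ≤ j → j ∉ A → AllMeasurable m (Y j)) → ∀ j, 1 ≤ j →
      AllMeasurable m (X' A j) := by
    intro A m h1 h2 h3 j hj
    refine AllMeasurable.stepOf (y := fun i => if i ∈ A then fun _ => 1 else Y i)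
      (fun i hi _ => h1 i hi) (fun i hi _ => h2 i hi) (fun i hi _ => ?_) hj le_rfl
      fun ω i hi => hmem i hi ω
    by_cases hiA : i ∈ A
    · simpa only [if_pos hiA] using AllMeasurable.const _
    · simpa only [if_neg hiA] using h3 i hi hiA
  set V : Finset ℕ → Ω → (Finset.Icc 1 n → G) := fun A ω j => X' A j ω with hV
  have hVmeas : ∀ (A : Finset ℕ) (m : MeasurableSpace Ω),
      (∀ j, 2 ≤ j → AllMeasurable m (ξ j)) → (∀ j, 2 ≤ j →
      AllMeasurable m (u j)) → (∀ j, 1 ≤ j → j ∉ A → AllMeasurable m (Y j)) →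
      AllMeasurable m (V A) := by
    intro A m h1 h2 h3
    exact AllMeasurable.pi (f := fun (j : Finset.Icc 1 n) ω => X' A j ω) fun j =>
      hX'meas A m h1 h2 h3 j (Finset.mem_Icc.1 j.2).1
  have hVΩ : ∀ A, AllMeasurable mΩ (V A) := fun A => hVmeas A mΩ
    (fun _ hj => h.flag_allMeasurable hj) (fun _ hj => h.index_allMeasurable hj)
    fun _ hj _ => h.fresh_allMeasurable hj
  -- On `B A v` the steps outside `A` are fixed by `v`, while `B A v` is independent of the samples
  -- at times in `A`.
  set B : Finset ℕ → (Finset.Icc 1 n → G) → Set Ω := fun A v =>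
    {ω | I ω = A} ∩ {ω | V A ω = v} with hB
  have hsplit : ∀ E : Set Ω, P.real E =
      ∑ A ∈ (Finset.Icc 1 n).powerset, ∑ v, P.real (B A v ∩ E) := by
    intro E
    rw [measureReal_eq_sum_fibers hImeas _ hIF E]
    refine Finset.sum_congr rfl fun A _ => ?_
    rw [measureReal_eq_sum_fibers (hVΩ A) Finset.univ (fun _ => Finset.mem_univ _)]
    refine Finset.sum_congr rfl fun v _ => ?_
    rw [hB, Set.inter_assoc, Set.inter_comm]
  have hkey : ∀ A ∈ (Finset.Icc 1 n).powerset, ∀ v,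
      |P.real (B A v ∩ {ω | S n ω = x}) - P.real (B A v) / Fintype.card G| ≤
        P.real (B A v) * Real.exp (-t) ^ A.card := by
    intro A hA v
    set g : ℕ → G := fun j => if hj : j ∈ Finset.Icc 1 n then v ⟨j, hj⟩ else 1 with hg
    have hS : B A v ∩ {ω | S n ω = x} = B A v ∩
        {ω | prefixProd (fun j => if j ∈ A then Y j ω else g j) n = x} := by
      ext ω
      refine and_congr_right fun hω => ?_
      have hIA : I ω = A := hω.1
      have hVv : V A ω = v := hω.2
      rw [Set.mem_ofPred_eq, Set.mem_ofPred_eq, h.walk_eq,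
        prefixProd_congr (z' := fun j => if j ∈ A then Y j ω else g j)]
      intro j hj
      have hj1 := (Finset.mem_Icc.1 hj).1
      rw [h.step_eq ω hj1]
      by_cases hjA : j ∈ A
      · rw [if_pos hjA]
        exact stepOf_of_mem_isolated (hIA ▸ hjA : j ∈ I ω)
      · rw [if_neg hjA, hg]
        simp only [dif_pos hj]
        rw [← hVv]
        refine stepOf_congr_of_notMem_isolated (fun i hi => h.index_mem i hi ω)
          (fun i _ hi => ?_) hj (hIA ▸ hjA : j ∉ I ω)
        have hiA : i ∉ A := hIA ▸ hi
        rw [if_neg hiA]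
    rw [hS]
    refine abs_measureReal_prefixProd_sub_le ht (fun j hj => h.fresh_allMeasurable hj) (B A v) A g
      (Finset.mem_powerset.1 hA) (fun i hi y a => ?_) x
    have hlaw : P.real {ω | Y (i + 1) ω = a} = (μ a).toReal := by
      rw [measureReal_def, h.law_fresh (i + 1) (by omega)]
    have hfl : ∀ j, 2 ≤ j → AllMeasurable (⨆ k ∈ ({Sum.inr (Sum.inr i)}ᶜ : Set (ℕ ⊕ ℕ ⊕ ℕ)),
        source ξ u Y k) (ξ j) := fun j hj => allMeasurable_flag hj (by simp)
    have hix : ∀ j, 2 ≤ j → AllMeasurable (⨆ k ∈ ({Sum.inr (Sum.inr i)}ᶜ : Set (ℕ ⊕ ℕ ⊕ ℕ)),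
        source ξ u Y k) (u j) := fun j hj => allMeasurable_index hj (by simp)
    have hfr : ∀ j, 1 ≤ j → j ≠ i + 1 →
        AllMeasurable (⨆ k ∈ ({Sum.inr (Sum.inr i)}ᶜ : Set (ℕ ⊕ ℕ ⊕ ℕ)),
        source ξ u Y k) (Y j) := fun j hj hne => allMeasurable_fresh hj (by simp; omega)
    have hpre : AllMeasurable (⨆ k ∈ ({Sum.inr (Sum.inr i)}ᶜ : Set (ℕ ⊕ ℕ ⊕ ℕ)),
        source ξ u Y k) fun ω => prefixProd (fun j => if j ∈ A then Y j ω else g j) i :=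
      AllMeasurable.prefixProd (z := fun j ω => if j ∈ A then Y j ω else g j) fun j hj => by
        rw [Finset.mem_Icc] at hj
        by_cases hjA : j ∈ A
        · simpa only [if_pos hjA] using hfr j hj.1 (by omega)
        · simpa only [if_neg hjA] using AllMeasurable.const _
    have hown : AllMeasurable (⨆ k ∈ ({Sum.inr (Sum.inr i)} : Set (ℕ ⊕ ℕ ⊕ ℕ)),
        source ξ u Y k) (Y (i + 1)) := allMeasurable_fresh (by omega) (by simp)
    have hIrest : AllMeasurable (⨆ k ∈ ({Sum.inr (Sum.inr i)}ᶜ : Set (ℕ ⊕ ℕ ⊕ ℕ)),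
        source ξ u Y k) I :=
      AllMeasurable.isolated (fun j hj _ => hfl j hj) fun j hj _ => hix j hj
    have hVrest := hVmeas A _ hfl hix
      fun j hj hjA => hfr j hj (by rintro rfl; exact hjA hi)
    rw [Set.inter_comm, h.measureReal_inter (hown.fiber a)
      (((hIrest.fiber A).inter (hVrest.fiber v)).inter (hpre.fiber y)), hlaw, mul_comm]
  have hB1 : ∀ A, ∑ v, P.real (B A v) = P.real {ω | I ω = A} := fun A =>
    (measureReal_eq_sum_fibers (hVΩ A) Finset.univ (fun _ => Finset.mem_univ _) _).symm
  have hone : ∑ A ∈ (Finset.Icc 1 n).powerset, ∑ v, P.real (B A v) = 1 := by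
    have := hsplit Set.univ
    simp only [Set.inter_univ, probReal_univ] at this
    exact this.symm
  have hexp : ∀ k : ℕ, Real.exp (-t * k) = Real.exp (-t) ^ k := fun k => by
    rw [mul_comm, Real.exp_nat_mul]
  have hint := integral_comp_eq_sum (P := P) hImeas _ hIF fun A => Real.exp (-t * A.card)
  rw [hint, hsplit {ω | S n ω = x}, ← one_div, ← hone, Finset.sum_div, ← Finset.sum_sub_distrib]
  refine (Finset.abs_sum_le_sum_abs _ _).trans (Finset.sum_le_sum fun A hA => ?_)
  rw [Finset.sum_div, ← Finset.sum_sub_distrib, ← hB1, Finset.sum_mul]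
  refine (Finset.abs_sum_le_sum_abs _ _).trans (Finset.sum_le_sum fun v _ => ?_)
  rw [hexp]
  exact hkey A hA v

end IsConstruction

end Construction

/-! ### Explicit rate and conclusion -/

lemma IsConstruction.integral_exp_card_isolated_le_exp {G Ω : Type*} [Group G]
    [MeasurableSpace Ω] {P : Measure Ω} [IsProbabilityMeasure P] {α : ℝ} {μ : PMF G}
    {ξ : ℕ → Ω → Bool} {u : ℕ → Ω → ℕ} {Y X S : ℕ → Ω → G}
    (h : IsConstruction P α μ ξ u Y X S) (hα0 : 0 ≤ α) (hα1 : α ≤ 1) {t : ℝ} (ht0 : 0 ≤ t)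
    (ht1 : t ≤ 1) (n : ℕ) :
    ∫ ω, Real.exp (-t * (isolated (fun j => ξ j ω) (fun j => u j ω) n).card) ∂P ≤
      Real.exp (t / 2) * Real.exp (-(t / 6)) ^ ((1 - α) * (n : ℝ)) := by
  rw [← Real.exp_mul, ← Real.exp_add]
  by_cases hn : 3 ≤ n
  · have hn3 : (3 : ℝ) ≤ n := by exact_mod_cast hn
    have hd : (0 : ℝ) < (n - 1) * (n - 2) := mul_pos (by linarith) (by linarith)
    have hct : t / ((n - 1) * (n - 2)) * ((n - 1) * (n - 2)) = t := div_mul_cancel₀ _ hd.ne'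
    -- This `c` makes the exponent at the final time equal to `t`; it requires `n ≥ 3`.
    have hmain := h.integral_exp_card_isolated_le hα0 hα1 (c := t / ((n - 1) * (n - 2)))
      (by positivity) (n := n) (by omega) (by rw [hct]; exact ht1)
    have hct' : t / ((n - 1) * (n - 2)) * (n * (n - 1) * (n - 2)) = t * n := by
      rw [mul_assoc (n : ℝ), mul_left_comm, hct, mul_comm]
    rw [hct, hct'] at hmain
    refine hmain.trans (Real.exp_le_exp.2 ?_)
    linarith
  -- For small `n` the trivial bound `1` suffices: `(1 - α) * n * t / 6 ≤ t / 2`, which the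
  -- prefactor `exp (t / 2)` absorbs.
  · have hn3 : (n : ℝ) ≤ 3 := by exact_mod_cast (by omega : n ≤ 3)
    have h1 : ∫ ω, Real.exp (-t * (isolated (fun j => ξ j ω) (fun j => u j ω) n).card) ∂P ≤
        ∫ _, (1 : ℝ) ∂P := by
      refine integral_comp_mono (h.isolated_allMeasurable n) (Finset.Icc 1 n).powerset
        (fun ω => Finset.mem_powerset.2 (isolated_subset n))
        (fun A => Real.exp (-t * A.card)) (fun _ => 1) fun A _ => ?_
      refine Real.exp_le_one_iff.2 ?_
      rw [neg_mul, neg_nonpos]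
      positivity
    refine h1.trans ?_
    rw [integral_const, probReal_univ, one_smul]
    refine Real.one_le_exp ?_
    have : (1 - α) * (n : ℝ) ≤ 1 * 3 :=
      mul_le_mul (by linarith) hn3 n.cast_nonneg zero_le_one
    nlinarith

lemma hasUniformDecay_of_closure_eq_top {G : Type u} [Group G] [Fintype G] {μ : PMF G}
    (hμ : Subgroup.closure (μ.support * μ.support⁻¹) = ⊤) : HasUniformDecay.{u, v} μ := by
  obtain ⟨t, ht0, ht1, ht⟩ := exists_conv_contraction hμ
  have hcard : (0 : ℝ) < Fintype.card G := by exact_mod_cast Fintype.card_pos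
  refine ⟨Fintype.card G * Real.exp (t / 2), Real.exp (-(t / 6)), by positivity,
    Real.exp_pos _, Real.exp_lt_one_iff.2 (by linarith), ?_⟩
  rintro α hα0 hα1 Ω _ P _ S ⟨ξ, u, Y, X, h⟩ n -
  refine Finset.sup'_le _ _ fun x _ => ?_
  have h1 := (h.abs_measureReal_walk_sub_le ht n x).trans
    (h.integral_exp_card_isolated_le_exp hα0 hα1.le ht0.le ht1 n)
  have h2 : P.real {ω | S n ω = x} * (Fintype.card G : ℝ) - 1 =
      Fintype.card G * (P.real {ω | S n ω = x} - (Fintype.card G : ℝ)⁻¹) := by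
    field_simp
  rw [h2, abs_mul, abs_of_pos hcard, mul_assoc]
  exact mul_le_mul_of_nonneg_left h1 hcard.le

end SRRW

theorem theorem1p10 {G : Type u} [Group G] [Fintype G] [DecidableEq G] [Nontrivial G]
    (μ : PMF G)
    (hirr : (SRRW.transitionMatrix μ).IsIrreducible)
    (haper : SRRW.IsAperiodic (SRRW.transitionMatrix μ)) :
    (Subgroup.closure (μ.support * μ.support⁻¹) = ⊤ → SRRW.HasUniformDecay.{u, v} μ) ∧
    -- the support is symmetric
    (μ.support = μ.support⁻¹ →
      Subgroup.closure (μ.support * μ.support⁻¹) = ⊤ ∧ SRRW.HasUniformDecay.{u, v} μ) ∧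
    -- the support is a union of conjugacy classes
    ((∃ T : Set (ConjClasses G), μ.support = ⋃ c ∈ T, c.carrier) →
      Subgroup.closure (μ.support * μ.support⁻¹) = ⊤ ∧ SRRW.HasUniformDecay.{u, v} μ) ∧
    -- the group is abelian
    ((∀ a b : G, a * b = b * a) →
      Subgroup.closure (μ.support * μ.support⁻¹) = ⊤ ∧ SRRW.HasUniformDecay.{u, v} μ) ∧
    -- the identity belongs to the support
    ((1 : G) ∈ μ.support →
      Subgroup.closure (μ.support * μ.support⁻¹) = ⊤ ∧ SRRW.HasUniformDecay.{u, v} μ) := by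
  have hconj : (∀ b ∈ μ.support, ∀ x ∈ μ.support, b * x * b⁻¹ ∈ μ.support) →
      Subgroup.closure (μ.support * μ.support⁻¹) = ⊤ := fun h =>
    SRRW.closure_support_mul_inv_eq_top_of_normal hirr haper
      (SRRW.closure_normal_of_support_conj hirr fun b hb x hx y hy => by
        have e : b * (x * y⁻¹) * b⁻¹ = (b * x * b⁻¹) * (b * y * b⁻¹)⁻¹ := by group
        rw [e]
        exact Subgroup.subset_closure
          (Set.mul_mem_mul (h b hb x hx) (Set.inv_mem_inv.2 (h b hb y hy))))
  have hdecay : Subgroup.closure (μ.support * μ.support⁻¹) = ⊤ →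
      Subgroup.closure (μ.support * μ.support⁻¹) = ⊤ ∧ SRRW.HasUniformDecay.{u, v} μ :=
    fun h => ⟨h, SRRW.hasUniformDecay_of_closure_eq_top h⟩
  refine ⟨SRRW.hasUniformDecay_of_closure_eq_top, fun h => hdecay ?_, fun h => hdecay ?_,
    fun h => hdecay ?_, fun h => hdecay ?_⟩
  · refine SRRW.closure_support_mul_inv_eq_top_of_normal hirr haper
      (SRRW.closure_normal_of_support_conj hirr fun b hb x hx y hy => ?_)
    -- Symmetry turns `ΓΓ` into `ΓΓ⁻¹`, so a conjugated generator is `(b * x) * (b * y)⁻¹` with both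
    -- factors in the subgroup.
    have hgen : ∀ p ∈ μ.support, ∀ q ∈ μ.support, p * q ∈
        Subgroup.closure (μ.support * μ.support⁻¹) := fun p hp q hq =>
      Subgroup.subset_closure (Set.mul_mem_mul hp (h ▸ hq))
    have e : b * (x * y⁻¹) * b⁻¹ = (b * x) * (b * y)⁻¹ := by group
    rw [e]
    exact Subgroup.mul_mem _ (hgen b hb x hx) (Subgroup.inv_mem _ (hgen b hb y hy))
  · obtain ⟨T, hT⟩ := h
    refine hconj fun b _ x hx => ?_
    rw [hT, Set.mem_iUnion₂] at hx ⊢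
    obtain ⟨c, hc, hxc⟩ := hx
    refine ⟨c, hc, ?_⟩
    rw [ConjClasses.mem_carrier_iff_mk_eq] at hxc ⊢
    rw [← hxc, ConjClasses.mk_eq_mk_iff_isConj]
    exact (isConj_iff.2 ⟨b, rfl⟩ : IsConj x _).symm
  · refine hconj fun b _ x hx => ?_
    rwa [h b x, mul_inv_cancel_right]
  · refine SRRW.eq_top_of_support_subset hirr fun b hb => Subgroup.subset_closure ?_
    have := Set.mul_mem_mul hb (Set.inv_mem_inv.2 h)
    rwa [inv_one, mul_one] at this
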